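/- All spaces are Hausdorff. A condensation is a continuous bijection. Let $\tau$ be an infinite cardinal. A compact Hausdorff space $X$ is called an $a_\tau$-space if for each $C\subseteq X$ with $|C|\le\tau$ there is a condensation from $X\setminus C$ onto a compact Hausdorff space (possibly empty). It is called a strictly $a_\tau$-space if for each $C\subseteq X$ with $|C|\le\tau$ and $X\setminus C\neq\emptyset$ there are a condensation $f$ from $X\setminus C$ onto a compact Hausdorff space $Y$ and a continuous map $\tilde f:X\to Y$ extending $f$. Theorem 2.15. Let $\{X_\alpha:\alpha\in\Lambda\}$ be a family of compact Hausdorff spaces, and let $X=\bigoplus\{X_\alpha:\alpha\in\Lambda\}\cup\{\xi\}$ be the disjoint union of the $X_\alpha$ with one added point $\xi$, with the topology in which $U\subseteq X$ is open if and only if $U\cap X_\alpha$ is open in $X_\alpha$ for each $\alpha\in\Lambda$ and, in case $\xi\in U$, $X_\alpha\subseteq U$ for all but finitely many $\alpha\in\Lambda$. Then 1. $X$ is an $a_\tau$-space if and only if $X_\alpha$ is an $a_\tau$-space for each $\alpha\in\Lambda$; 2. $X$ is a strictly $a_\tau$-space if and only if $X_\alpha$ is a strictly $a_\tau$-space for each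 $\alpha\in\Lambda$. -/

import Mathlib

open Set Cardinal

universe u v w

/-- A condensation: a continuous bijection. -/
def IsCondensation {X : Type u} {Y : Type v} [TopologicalSpace X] [TopologicalSpace Y]
    (f : X → Y) : Prop :=
  Continuous f ∧ Function.Bijective f

/-- An `a_τ`-space: a compact Hausdorff space `X` such that for each `C ⊆ X` with `|C| ≤ τ` there
is a condensation of `X \ C` onto a compact Hausdorff space. The target is in bijection with a
subset of `X`, so taking it in the universe of `X` is no restriction. -/
def IsASpace (τ : Cardinal.{w}) (X : Type u) [TopologicalSpace X] : Prop :=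
  CompactSpace X ∧ T2Space X ∧
    ∀ C : Set X, Cardinal.lift.{w} #C ≤ Cardinal.lift.{u} τ →
      ∃ (Y : Type u) (_ : TopologicalSpace Y) (f : ↥(Cᶜ) → Y),
        CompactSpace Y ∧ T2Space Y ∧ IsCondensation f

/-- A strictly `a_τ`-space: a compact Hausdorff space `X` such that for each `C ⊆ X` with
`|C| ≤ τ` and `X \ C` nonempty there is a condensation `f` of `X \ C` onto a compact Hausdorff
space `Y` which extends to a continuous map `X → Y`. (For `C = X ≠ ∅` the only condensation of
`X \ C` is onto the empty space, to which `X` has no map at all; so this degenerate choice of `C`,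
possible only if `|X| ≤ τ`, is left out.) -/
def IsStrictlyASpace (τ : Cardinal.{w}) (X : Type u) [TopologicalSpace X] : Prop :=
  CompactSpace X ∧ T2Space X ∧
    ∀ C : Set X, Cardinal.lift.{w} #C ≤ Cardinal.lift.{u} τ → (Cᶜ).Nonempty →
      ∃ (Y : Type u) (_ : TopologicalSpace Y) (f : ↥(Cᶜ) → Y) (g : X → Y),
        CompactSpace Y ∧ T2Space Y ∧ IsCondensation f ∧
          Continuous g ∧ ∀ x : ↥(Cᶜ), g x = f x

/-- The underlying set of `⨁ {X_α : α ∈ Λ} ∪ {ξ}`. -/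
inductive SumWithPoint {Λ : Type v} (X : Λ → Type u) : Type (max u v)
  /-- The added point `ξ`. -/
  | xi : SumWithPoint X
  /-- The points of the summands. -/
  | of (α : Λ) (x : X α) : SumWithPoint X

/-- The topology of `⨁ {X_α : α ∈ Λ} ∪ {ξ}`: a set is open iff its trace on each `X_α` is open
and, in case it contains `ξ`, it contains all but finitely many of the sets `X_α`. Thus each `X_α`
is an open subspace, and the sets `{ξ} ∪ ⋃ {X_α : α ∉ F}`, `F` finite, form a neighbourhood base
at `ξ`. -/
instance SumWithPoint.instTopologicalSpace {Λ : Type v} (X : Λ → Type u)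
    [∀ α, TopologicalSpace (X α)] : TopologicalSpace (SumWithPoint X) where
  IsOpen U := (∀ α, IsOpen {x : X α | SumWithPoint.of α x ∈ U}) ∧
    (SumWithPoint.xi ∈ U → {α : Λ | ¬ ∀ x : X α, SumWithPoint.of α x ∈ U}.Finite)
  isOpen_univ := by simp
  isOpen_inter := by
    rintro U V ⟨hU, hU'⟩ ⟨hV, hV'⟩
    refine ⟨fun α => (hU α).inter (hV α), fun h => ?_⟩
    refine ((hU' h.1).union (hV' h.2)).subset fun α hα => ?_
    by_contra hn
    simp only [mem_union, mem_ofPred_eq, not_or, not_not] at hn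
    exact hα fun x => ⟨hn.1 x, hn.2 x⟩
  isOpen_sUnion := by
    intro S hS
    refine ⟨fun α => ?_, ?_⟩
    · have h : {x : X α | SumWithPoint.of α x ∈ ⋃₀ S} =
          ⋃ U ∈ S, {x : X α | SumWithPoint.of α x ∈ U} := by
        ext x
        simp
      rw [h]
      exact isOpen_biUnion fun U hU => (hS U hU).1 α
    · rintro ⟨U, hU, hxi⟩
      exact ((hS U hU).2 hxi).subset fun α hα h => hα fun x => ⟨U, hU, h x⟩

/-! Both directions build a compact Hausdorff space from given condensations and then correct it by
collapsing a closed set to a point, which keeps compactness and the Hausdorff property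
(`compactSpace_t2Space_coinduced_of_collapse`).

From the sum to `X α`: delete `C ⊆ X α` from the sum and condense the rest onto `Y`. The complement
of `X α` is compact, so its image in `Y` is closed. Gluing this image to the image of one point of
`X α \ C` leaves a quotient of `Y` in bijection with `X α \ C`
(`exists_compact_t2_quotient_summand`).

From the summands to the sum: the traces of `C` on the summands are no larger than `C`, so each `X α
\ C` condenses onto some `Y α`. Together these map the complement of `C` continuously and
injectively into the sum with a point of the `Y α`. Only the added point can be missed, namely when
`xi ∈ C`; it is then glued to a point that is hit (`exists_compact_t2_quotient`).

In the strict case the extensions are composed with the same quotient maps. -/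

/-- Collapsing a closed subset `A` of a compact Hausdorff space to a point gives a compact
Hausdorff space. -/
theorem compactSpace_t2Space_coinduced_of_collapse {Y : Type u} {Z : Type v}
    [tY : TopologicalSpace Y] [CompactSpace Y] [T2Space Y] {A : Set Y} (hA : IsClosed A) {r : Y → Z}
    (hr : Function.Surjective r) (hrA : ∀ x ∈ A, ∀ y ∈ A, r x = r y)
    (hinj : ∀ x y, r x = r y → x = y ∨ x ∈ A ∧ y ∈ A) :
    @CompactSpace Z (tY.coinduced r) ∧ @T2Space Z (tY.coinduced r) := by
  let _ : TopologicalSpace Z := tY.coinduced r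
  have hc : Continuous r := continuous_coinduced_rng
  have key : ∀ x y : Y, r x ≠ r y → y ∉ A →
      ∃ u v : Set Z, IsOpen u ∧ IsOpen v ∧ r x ∈ u ∧ r y ∈ v ∧ Disjoint u v := by
    intro x y hxy hy
    have hd : Disjoint (A ∪ {x}) {y} := by
      rw [Set.disjoint_singleton_right]
      rintro (h | rfl)
      · exact hy h
      · exact hxy rfl
    -- `U` contains `A` and `V` misses it, so both are unions of fibres of `r` and their images are
    -- open and disjoint.
    obtain ⟨U, V, hU, hV, hAU, hyV, hUV⟩ :=
      normal_separation (hA.union isClosed_singleton) isClosed_singleton hd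
    have hUs : r ⁻¹' (r '' U) = U := by
      refine subset_antisymm ?_ (subset_preimage_image r U)
      rintro b ⟨a, ha, hab⟩
      rcases hinj a b hab with rfl | h
      · exact ha
      · exact hAU (Or.inl h.2)
    have hVA : ∀ a ∈ V, a ∉ A := fun a ha h =>
      Set.disjoint_left.1 hUV (hAU (Or.inl h)) ha
    have hVs : r ⁻¹' (r '' V) = V := by
      refine subset_antisymm ?_ (subset_preimage_image r V)
      rintro b ⟨a, ha, hab⟩
      rcases hinj a b hab with rfl | h
      · exact ha
      · exact absurd h.1 (hVA a ha)
    refine ⟨r '' U, r '' V, ?_, ?_, mem_image_of_mem r (hAU (Or.inr rfl)),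
      mem_image_of_mem r (hyV rfl), ?_⟩
    · exact isOpen_coinduced.2 (by rwa [hUs])
    · exact isOpen_coinduced.2 (by rwa [hVs])
    · rw [Set.disjoint_left]
      rintro _ ⟨a, ha, rfl⟩ ⟨b, hb, hab⟩
      rcases hinj b a hab with rfl | h
      · exact Set.disjoint_left.1 hUV ha hb
      · exact hVA b hb h.1
  refine ⟨hr.compactSpace hc, ⟨fun z w hzw => ?_⟩⟩
  obtain ⟨x, rfl⟩ := hr z
  obtain ⟨y, rfl⟩ := hr w
  by_cases hy : y ∈ A
  · have hx : x ∉ A := fun hx => hzw (hrA x hx y hy)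
    obtain ⟨u, v, hu, hv, hyu, hxv, huv⟩ := key y x hzw.symm hx
    exact ⟨v, u, hv, hu, hxv, hyu, huv.symm⟩
  · exact key x y hzw hy

/-! ### Topology of the sum with a point -/

namespace SumWithPoint

variable {Λ : Type v} {X : Λ → Type u}

theorem of_injective (α : Λ) : Function.Injective (of (X := X) α) := fun _ _ h => by
  cases h; rfl

variable [∀ α, TopologicalSpace (X α)]

theorem isOpen_iff {U : Set (SumWithPoint X)} :
    IsOpen U ↔ (∀ α, IsOpen (of α ⁻¹' U)) ∧
      (xi ∈ U → {α : Λ | ¬ ∀ x : X α, of α x ∈ U}.Finite) := Iff.rfl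

theorem continuous_of (α : Λ) : Continuous (of (X := X) α) :=
  ⟨fun _ hU => (isOpen_iff.1 hU).1 α⟩

theorem isOpen_image_of {α : Λ} {U : Set (X α)} (hU : IsOpen U) :
    IsOpen (of α '' U) := by
  refine isOpen_iff.2 ⟨fun β => ?_, by simp⟩
  by_cases h : β = α
  · subst h
    rwa [preimage_image_eq _ (of_injective β)]
  · convert isOpen_empty
    ext x
    simp only [mem_preimage, mem_image, mem_empty_iff_false, iff_false]
    rintro ⟨y, -, hy⟩
    cases hy
    exact h rfl

/-- Only the summand `α` fails to lie in this set. Since the summands are also open, each of them is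
clopen, which separates its points from all points outside it. -/
theorem isOpen_compl_range_of [∀ α, CompactSpace (X α)] (α : Λ) :
    IsOpen (range (of (X := X) α))ᶜ := by
  refine isOpen_iff.2 ⟨fun β => ?_, fun _ => (finite_singleton α).subset fun β hβ => ?_⟩
  · by_cases h : β = α
    · subst h
      convert isOpen_empty
      ext x
      simp
    · convert isOpen_univ
      ext x
      simp only [mem_preimage, mem_compl_iff, mem_range, mem_univ, iff_true]
      rintro ⟨y, hy⟩
      cases hy
      exact h rfl
  · by_contra h
    refine hβ fun x => ?_
    rintro ⟨y, hy⟩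
    cases hy
    exact h rfl

instance [∀ α, CompactSpace (X α)] : CompactSpace (SumWithPoint X) := by
  refine ⟨isCompact_of_finite_subcover fun {ι} U hU hcov => ?_⟩
  -- A member of the cover containing `xi` leaves out points of only finitely many summands, and
  -- these are compact.
  obtain ⟨i, hi⟩ := mem_iUnion.1 (hcov (mem_univ xi))
  have hfin := (isOpen_iff.1 (hU i)).2 hi
  have hK : IsCompact (⋃ α ∈ {α : Λ | ¬ ∀ x : X α, of α x ∈ U i}, range (of (X := X) α)) :=
    hfin.isCompact_biUnion fun α _ => isCompact_range (continuous_of α)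
  obtain ⟨t, ht⟩ := hK.elim_finite_subcover U hU ((subset_univ _).trans hcov)
  classical
  refine ⟨insert i t, ?_⟩
  rintro (_ | ⟨α, x⟩) -
  · exact mem_biUnion (Finset.mem_insert_self i t) hi
  · by_cases hα : ∀ x : X α, of α x ∈ U i
    · exact mem_biUnion (Finset.mem_insert_self i t) (hα x)
    · obtain ⟨j, hj, hx⟩ := mem_iUnion₂.1 (ht (mem_biUnion (x := α) hα (mem_range_self x)))
      exact mem_biUnion (Finset.mem_insert_of_mem hj) hx

instance [∀ α, CompactSpace (X α)] [∀ α, T2Space (X α)] : T2Space (SumWithPoint X) := by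
  have key : ∀ (α : Λ) (x : X α) (z : SumWithPoint X), z ∉ range (of (X := X) α) →
      ∃ u v : Set (SumWithPoint X), IsOpen u ∧ IsOpen v ∧ of α x ∈ u ∧ z ∈ v ∧ Disjoint u v :=
    fun α x z hz => ⟨range (of α), (range (of α))ᶜ, by
      rw [← image_univ]; exact isOpen_image_of isOpen_univ, isOpen_compl_range_of α,
      mem_range_self x, hz, disjoint_compl_right⟩
  refine ⟨fun z w hzw => ?_⟩
  rcases z with _ | ⟨α, x⟩
  · rcases w with _ | ⟨β, y⟩
    · exact absurd rfl hzw
    · obtain ⟨u, v, hu, hv, h1, h2, h⟩ := key β y xi (by simp)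
      exact ⟨v, u, hv, hu, h2, h1, h.symm⟩
  · by_cases hw : w ∈ range (of (X := X) α)
    · obtain ⟨y, rfl⟩ := hw
      obtain ⟨u, v, hu, hv, h1, h2, h⟩ := t2_separation (fun h : x = y => hzw (h ▸ rfl))
      exact ⟨of α '' u, of α '' v, isOpen_image_of hu, isOpen_image_of hv,
        mem_image_of_mem _ h1, mem_image_of_mem _ h2,
        (disjoint_image_iff (of_injective α)).2 h⟩
    · exact key α x w hw

/-- A map between sums with a point that fixes the added point and maps each summand continuously
into the corresponding summand or constantly to the added point is continuous. -/
theorem continuous_of_summands {Y : Λ → Type w} [∀ α, TopologicalSpace (Y α)]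
    {G : SumWithPoint X → SumWithPoint Y} (hxi : G xi = xi)
    (hG : ∀ α, (∀ x, G (of α x) = xi) ∨
      ∃ g : X α → Y α, Continuous g ∧ ∀ x, G (of α x) = of α (g x)) : Continuous G := by
  refine ⟨fun U hU => isOpen_iff.2 ⟨fun α => ?_, fun h => ?_⟩⟩
  · rcases hG α with h | ⟨g, hg, h⟩
    · have : of α ⁻¹' (G ⁻¹' U) = {_x : X α | xi ∈ U} := by ext x; simp [h]
      rw [this]
      exact isOpen_const
    · have : of α ⁻¹' (G ⁻¹' U) = g ⁻¹' (of α ⁻¹' U) := by ext x; simp [h]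
      rw [this]
      exact ((isOpen_iff.1 hU).1 α).preimage hg
  · have hU' : xi ∈ U := by simpa [hxi] using h
    refine ((isOpen_iff.1 hU).2 hU').subset fun α hα hall => hα fun x => ?_
    rcases hG α with h | ⟨g, -, h⟩
    · simpa [h] using hU'
    · simpa [h] using hall (g x)

/-- Continuous maps of subspaces of the summands induce a continuous map of a subspace of the
sum with a point. -/
theorem continuous_restrict_of_summands {Y : Λ → Type w} [∀ α, TopologicalSpace (Y α)]
    {S : Set (SumWithPoint X)} {f : ∀ α, ↥(of (X := X) α ⁻¹' S) → Y α}
    (hf : ∀ α, Continuous (f α)) {h : S → SumWithPoint Y}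
    (hxi : ∀ hS : xi ∈ S, h ⟨xi, hS⟩ = xi)
    (hof : ∀ α x (hS : of α x ∈ S), h ⟨of α x, hS⟩ = of α (f α ⟨x, hS⟩)) : Continuous h := by
  refine ⟨fun U hU => ?_⟩
  -- The largest open set whose trace on `S` is mapped into `U`. Maximality matters at `xi`: if all
  -- of `Y α` lies in `U`, then `W α` is all of `X α`, including the points outside `S`.
  let W : ∀ α, Set (X α) := fun α => interior {x | ∀ hS : of α x ∈ S, of α (f α ⟨x, hS⟩) ∈ U}
  have hW : ∀ α x (hS : of α x ∈ S), of α (f α ⟨x, hS⟩) ∈ U → x ∈ W α := by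
    intro α x hS hx
    obtain ⟨O, hO, hOf⟩ := isOpen_induced_iff.1 (((isOpen_iff.1 hU).1 α).preimage (hf α))
    refine mem_interior.2 ⟨O, fun y hy hyS => ?_, hO, ?_⟩
    · have : (⟨y, hyS⟩ : ↥(of (X := X) α ⁻¹' S)) ∈ Subtype.val ⁻¹' O := hy
      rw [hOf] at this
      exact this
    · have : (⟨x, hS⟩ : ↥(of (X := X) α ⁻¹' S)) ∈ Subtype.val ⁻¹' O := by
        rw [hOf]
        exact hx
      exact this
  let V : Set (SumWithPoint X) := {z | (z = xi ∧ xi ∈ U) ∨ ∃ α, ∃ x ∈ W α, z = of α x}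
  have hofV : ∀ α x, of α x ∈ V ↔ x ∈ W α := by
    intro α x
    constructor
    · rintro (⟨h, -⟩ | ⟨β, y, hy, h⟩)
      · cases h
      · cases h
        exact hy
    · exact fun hx => Or.inr ⟨α, x, hx, rfl⟩
  have hxiV : xi ∈ V ↔ xi ∈ U := by
    constructor
    · rintro (⟨-, h⟩ | ⟨β, y, hy, h⟩)
      · exact h
      · cases h
    · exact fun h => Or.inl ⟨rfl, h⟩
  refine isOpen_induced_iff.2 ⟨V, isOpen_iff.2 ⟨fun α => ?_, fun hV => ?_⟩, ?_⟩
  · have : of α ⁻¹' V = W α := by ext x; exact hofV α x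
    rw [this]
    exact isOpen_interior
  · refine ((isOpen_iff.1 hU).2 (hxiV.1 hV)).subset fun α hα hall => hα fun x => ?_
    rw [hofV]
    have : {x | ∀ hS : of α x ∈ S, of α (f α ⟨x, hS⟩) ∈ U} = Set.univ :=
      eq_univ_of_forall fun y hS => hall _
    simp only [W, this, interior_univ, mem_univ]
  · ext ⟨z, hz⟩
    rcases z with _ | ⟨α, x⟩
    · simp only [mem_preimage, hxi, hxiV]
    · simp only [mem_preimage, hof, hofV]
      exact ⟨fun hx => interior_subset hx hz, hW α x hz⟩

/-! ### Passing from the sum to one summand -/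

/-- If a subspace of the sum with a point that contains all summands but one condenses onto a
compact Hausdorff space `Y`, then its trace on the remaining summand, if nonempty, is a quotient
of `Y`. -/
theorem exists_compact_t2_quotient_summand [∀ α, CompactSpace (X α)] {α : Λ} {C : Set (X α)}
    (hC : Cᶜ.Nonempty) {Y : Type w} [TopologicalSpace Y] [CompactSpace Y] [T2Space Y]
    {f : ↥((of (X := X) α '' C)ᶜ) → Y} (hf : IsCondensation f) :
    ∃ (Z : Type u) (_ : TopologicalSpace Z) (e : ↥(Cᶜ) → Z) (r : Y → Z),
      CompactSpace Z ∧ T2Space Z ∧ Function.Bijective e ∧ Continuous r ∧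
      ∀ x (h : x ∈ Cᶜ) (h' : of α x ∈ (of (X := X) α '' C)ᶜ), r (f ⟨of α x, h'⟩) = e ⟨x, h⟩ := by
  obtain ⟨hfc, hfb⟩ := hf
  have hmem : ∀ x ∈ Cᶜ, of α x ∈ (of (X := X) α '' C)ᶜ := fun x hx h =>
    hx ((of_injective α).mem_set_image.1 h)
  let i : ↥(Cᶜ) → Y := fun x => f ⟨of α x, hmem x x.2⟩
  have hi : Function.Injective i := fun x y h =>
    Subtype.ext (of_injective α (congrArg Subtype.val (hfb.1 h)))
  let p : ↥(Cᶜ) := ⟨_, hC.some_mem⟩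
  have : Nonempty ↥(Cᶜ) := ⟨p⟩
  let K : Set (SumWithPoint X) := (range (of α))ᶜ
  have hKC : K ⊆ (of (X := X) α '' C)ᶜ := compl_subset_compl.2 (image_subset_range _ _)
  have hK : IsCompact K := IsClosed.isCompact (by
    rw [isClosed_compl_iff, ← image_univ]
    exact isOpen_image_of isOpen_univ)
  have hK' : IsCompact (f '' (Subtype.val ⁻¹' K)) := by
    refine IsCompact.image ?_ hfc
    rw [Subtype.isCompact_iff, Subtype.image_preimage_coe, inter_eq_self_of_subset_right hKC]
    exact hK
  have hKi : f '' (Subtype.val ⁻¹' K) = (range i)ᶜ := by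
    ext y
    obtain ⟨⟨z, hz⟩, rfl⟩ := hfb.2 y
    rw [hfb.1.mem_set_image]
    simp only [K, i, mem_preimage, mem_compl_iff, not_iff_not, mem_range, hfb.1.eq_iff,
      Subtype.mk.injEq]
    constructor
    · rintro ⟨x, rfl⟩
      exact ⟨⟨x, fun hx => hz (mem_image_of_mem _ hx)⟩, rfl⟩
    · rintro ⟨x, rfl⟩
      exact ⟨x, rfl⟩
  let r : Y → ↥(Cᶜ) := Function.extend i id fun _ => p
  have hri : ∀ x, r (i x) = x := fun x => hi.extend_apply id _ x
  have hr0 : ∀ y, y ∉ range i → r y = p := fun y hy => Function.extend_apply' _ _ _ hy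
  -- This is the fibre of `r` over `p`. Including `i p` avoids a new point in the quotient, so that
  -- its points are exactly those of `Cᶜ`.
  let A : Set Y := f '' (Subtype.val ⁻¹' K) ∪ {i p}
  have hrA : ∀ y ∈ A, r y = p := by
    rintro y (hy | rfl)
    · rw [hKi] at hy
      exact hr0 y hy
    · exact hri p
  obtain ⟨h1, h2⟩ := compactSpace_t2Space_coinduced_of_collapse (A := A) (r := r)
    (hK'.isClosed.union isClosed_singleton) (fun x => ⟨i x, hri x⟩)
    (fun x hx y hy => (hrA x hx).trans (hrA y hy).symm) (by
      have hAi : ∀ y, y ∉ range i → y ∈ A := fun y hy => Or.inl (hKi ▸ hy)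
      intro y z h
      by_cases hy : y ∈ range i
      · obtain ⟨a, rfl⟩ := hy
        by_cases hz : z ∈ range i
        · obtain ⟨b, rfl⟩ := hz
          rw [hri, hri] at h
          exact Or.inl (h ▸ rfl)
        · rw [hri, hr0 z hz] at h
          exact Or.inr ⟨Or.inr (h ▸ rfl), hAi z hz⟩
      · by_cases hz : z ∈ range i
        · obtain ⟨b, rfl⟩ := hz
          rw [hri, hr0 y hy] at h
          exact Or.inr ⟨hAi y hy, Or.inr (h ▸ rfl)⟩
        · exact Or.inr ⟨hAi y hy, hAi z hz⟩)
  exact ⟨↥(Cᶜ), _, id, r, h1, h2, Function.bijective_id, continuous_coinduced_rng,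
    fun x h _ => hri ⟨x, h⟩⟩

end SumWithPoint

/-- The empty space condenses onto a compact Hausdorff space. -/
theorem exists_condensation_of_isEmpty (S : Type u) [TopologicalSpace S] [IsEmpty S] :
    ∃ (Y : Type u) (_ : TopologicalSpace Y) (f : S → Y),
      CompactSpace Y ∧ T2Space Y ∧ IsCondensation f :=
  ⟨S, inferInstance, id, inferInstance, inferInstance, continuous_id, Function.bijective_id⟩

/-! ### Gluing condensations of the summands -/

namespace SumWithPoint

variable {Λ : Type v} {X : Λ → Type u}

/-- A bijection of each summand of `S` with a compact Hausdorff space `Y α` makes `S` a quotient of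
the sum with a point of the `Y α`: if the added point is not in `S`, it is identified with some
point `p` of `S`. -/
theorem exists_compact_t2_quotient {Y : Λ → Type w} [∀ α, TopologicalSpace (Y α)]
    [∀ α, CompactSpace (Y α)] [∀ α, T2Space (Y α)] {S : Set (SumWithPoint X)}
    {f : ∀ α, ↥(of (X := X) α ⁻¹' S) → Y α} (hf : ∀ α, Function.Bijective (f α))
    (hS : S.Nonempty) :
    ∃ (Z : Type (max u v)) (_ : TopologicalSpace Z) (e : S → Z) (r : SumWithPoint Y → Z),
      CompactSpace Z ∧ T2Space Z ∧ Function.Bijective e ∧ Continuous r ∧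
      (∀ h : xi ∈ S, r xi = e ⟨xi, h⟩) ∧
      ∀ α x (h : of α x ∈ S), r (of α (f α ⟨x, h⟩)) = e ⟨of α x, h⟩ := by
  -- If `xi ∈ S`, then `p` is `xi` itself and nothing is identified.
  obtain ⟨p, hp⟩ : ∃ p : S, ∀ h : xi ∈ S, p = ⟨xi, h⟩ := by
    by_cases h : xi ∈ S
    · exact ⟨⟨xi, h⟩, fun _ => rfl⟩
    · exact ⟨⟨_, hS.some_mem⟩, fun h' => absurd h' h⟩
  let e : ∀ α, ↥(of (X := X) α ⁻¹' S) ≃ Y α := fun α => Equiv.ofBijective (f α) (hf α)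
  let r : SumWithPoint Y → S := fun z => match z with
    | xi => p
    | of α y => ⟨of α ((e α).symm y).1, ((e α).symm y).2⟩
  have hr : ∀ α x (h : of α x ∈ S), r (of α (f α ⟨x, h⟩)) = ⟨of α x, h⟩ := by
    intro α x h
    have : (e α).symm (f α ⟨x, h⟩) = ⟨x, h⟩ := (e α).symm_apply_apply ⟨x, h⟩
    simp only [r, this]
  have hinj : ∀ α y β y', r (of α y) = r (of β y') → (of α y : SumWithPoint Y) = of β y' := by
    intro α y β y' h
    have h' : (of α ((e α).symm y).1 : SumWithPoint X) = of β ((e β).symm y').1 :=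
      congrArg Subtype.val h
    obtain rfl : α = β := by injection h'
    exact congrArg (of α) ((e α).symm.injective (Subtype.ext (of_injective α h')))
  let A : Set (SumWithPoint Y) := {z | r z = p}
  have hA : IsClosed A := by
    -- Besides `xi`, at most one point lies over `p`.
    refine Set.Finite.isClosed ?_
    have hsub : (A \ {xi}).Subsingleton := by
      rintro (_ | ⟨α, y⟩) ⟨hz, hz'⟩ (_ | ⟨β, y'⟩) ⟨hw, hw'⟩
      · rfl
      · exact absurd rfl hz'
      · exact absurd rfl hw'
      · exact hinj α y β y' (hz.trans hw.symm)
    exact (hsub.finite.union (finite_singleton xi)).subset (by simp)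
  have hsurj : Function.Surjective r := by
    rintro ⟨_ | ⟨α, x⟩, h⟩
    · exact ⟨xi, hp h⟩
    · exact ⟨of α (f α ⟨x, h⟩), hr α x h⟩
  obtain ⟨h1, h2⟩ := compactSpace_t2Space_coinduced_of_collapse hA hsurj
    (fun x hx y hy => hx.trans hy.symm) (by
      rintro (_ | ⟨α, y⟩) (_ | ⟨β, y'⟩) h
      · exact Or.inl rfl
      · exact Or.inr ⟨rfl, h.symm⟩
      · exact Or.inr ⟨h, rfl⟩
      · exact Or.inl (hinj α y β y' h))
  exact ⟨S, _, id, r, h1, h2, Function.bijective_id, continuous_coinduced_rng, hp, hr⟩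

theorem lift_mk_preimage_of_le {τ : Cardinal.{w}} {C : Set (SumWithPoint X)}
    (hC : Cardinal.lift.{w} #C ≤ Cardinal.lift.{max u v} τ) (α : Λ) :
    Cardinal.lift.{w} #(of (X := X) α ⁻¹' C) ≤ Cardinal.lift.{u} τ := by
  have h := Cardinal.lift_le.{w}.2
    (Cardinal.mk_preimage_of_injective_lift (of (X := X) α) C (of_injective α))
  have hC' := Cardinal.lift_le.{u}.2 hC
  rw [← Cardinal.lift_le.{max u v}]
  simp only [Cardinal.lift_lift] at h hC' ⊢
  exact h.trans hC'

theorem lift_mk_image_of_le {τ : Cardinal.{w}} {α : Λ} {C : Set (X α)}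
    (hC : Cardinal.lift.{w} #C ≤ Cardinal.lift.{u} τ) :
    Cardinal.lift.{w} #(of (X := X) α '' C) ≤ Cardinal.lift.{max u v} τ := by
  have h := Cardinal.lift_le.{w}.2
    (Cardinal.mk_image_le_lift (f := of (X := X) α) (s := C))
  have hC' := Cardinal.lift_le.{max u v}.2 hC
  rw [← Cardinal.lift_le.{u}]
  simp only [Cardinal.lift_lift] at h hC' ⊢
  exact h.trans hC'

/-! ### The four implications -/

variable [∀ α, TopologicalSpace (X α)] [∀ α, CompactSpace (X α)] [∀ α, T2Space (X α)]
  {τ : Cardinal.{w}}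

theorem isASpace_of_sumWithPoint (h : IsASpace τ (SumWithPoint X)) (α : Λ) :
    IsASpace τ (X α) := by
  refine ⟨inferInstance, inferInstance, fun C hC => ?_⟩
  -- The collapse needs a point of `Cᶜ` to glue to.
  rcases (Cᶜ).eq_empty_or_nonempty with h0 | h0
  · have : IsEmpty ↥(Cᶜ) := isEmpty_coe_sort.2 h0
    exact exists_condensation_of_isEmpty _
  obtain ⟨Y, _, f, _, _, hf⟩ := h.2.2 (of α '' C) (lift_mk_image_of_le hC)
  obtain ⟨Z, _, e, r, h1, h2, he, hr, hrf⟩ := exists_compact_t2_quotient_summand h0 hf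
  have hmem : ∀ x : ↥(Cᶜ), of α x.1 ∈ (of (X := X) α '' C)ᶜ := fun x h =>
    x.2 ((of_injective α).mem_set_image.1 h)
  have heq : (fun x : ↥(Cᶜ) => r (f ⟨of α x, hmem x⟩)) = e := by
    ext1 x
    exact hrf x x.2 (hmem x)
  refine ⟨Z, _, e, h1, h2, ?_, he⟩
  rw [← heq]
  exact hr.comp (hf.1.comp (((continuous_of α).comp continuous_subtype_val).subtype_mk _))

theorem isStrictlyASpace_of_sumWithPoint (h : IsStrictlyASpace τ (SumWithPoint X)) (α : Λ) :
    IsStrictlyASpace τ (X α) := by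
  refine ⟨inferInstance, inferInstance, fun C hC h0 => ?_⟩
  have hmem : ∀ x : ↥(Cᶜ), of α x.1 ∈ (of (X := X) α '' C)ᶜ := fun x h =>
    x.2 ((of_injective α).mem_set_image.1 h)
  obtain ⟨Y, _, f, g, _, _, hf, hg, hgf⟩ := h.2.2 (of α '' C) (lift_mk_image_of_le hC)
    ⟨_, hmem ⟨_, h0.some_mem⟩⟩
  obtain ⟨Z, _, e, r, h1, h2, he, hr, hrf⟩ := exists_compact_t2_quotient_summand h0 hf
  have hgr : ∀ x : ↥(Cᶜ), r (g (of α x)) = e x := fun x => by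
    rw [hgf ⟨_, hmem x⟩]
    exact hrf x x.2 (hmem x)
  have hc : Continuous fun x => r (g (of α x)) := hr.comp (hg.comp (continuous_of α))
  have heq : (fun x : ↥(Cᶜ) => r (g (of α x))) = e := funext hgr
  refine ⟨Z, _, e, fun x => r (g (of α x)), h1, h2, ⟨?_, he⟩, hc, hgr⟩
  rw [← heq]
  exact hc.comp continuous_subtype_val

theorem isASpace_sumWithPoint (h : ∀ α, IsASpace τ (X α)) : IsASpace τ (SumWithPoint X) := by
  refine ⟨inferInstance, inferInstance, fun C hC => ?_⟩
  rcases (Cᶜ).eq_empty_or_nonempty with h0 | h0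
  · have : IsEmpty ↥(Cᶜ) := isEmpty_coe_sort.2 h0
    exact exists_condensation_of_isEmpty _
  choose Y tY f hY1 hY2 hf using fun α => (h α).2.2 _ (lift_mk_preimage_of_le hC α)
  obtain ⟨Z, _, e, r, h1, h2, he, hr, hrxi, hrf⟩ := exists_compact_t2_quotient (S := Cᶜ) (f := f)
    (fun α => (hf α).2) h0
  let k : ↥(Cᶜ) → SumWithPoint Y := fun z => match z with
    | ⟨xi, _⟩ => xi
    | ⟨of α x, hx⟩ => of α (f α ⟨x, hx⟩)
  have hk : Continuous k := continuous_restrict_of_summands (f := f) (fun α => (hf α).1)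
    (fun _ => rfl) (fun _ _ _ => rfl)
  have heq : r ∘ k = e := by
    ext1 ⟨z, hz⟩
    rcases z with _ | ⟨α, x⟩
    · exact hrxi hz
    · exact hrf α x hz
  exact ⟨Z, _, e, h1, h2, heq ▸ hr.comp hk, he⟩

theorem isStrictlyASpace_sumWithPoint (h : ∀ α, IsStrictlyASpace τ (X α)) :
    IsStrictlyASpace τ (SumWithPoint X) := by
  refine ⟨inferInstance, inferInstance, fun C hC h0 => ?_⟩
  -- Strictness says nothing about a summand contained in `C`. There `Y` is empty and no extension
  -- is available; `G` below sends such a summand to `xi`.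
  have hdata : ∀ α, ∃ (Y : Type u) (_ : TopologicalSpace Y) (f : ↥((of (X := X) α ⁻¹' C)ᶜ) → Y),
      CompactSpace Y ∧ T2Space Y ∧ IsCondensation f ∧ (((of (X := X) α ⁻¹' C)ᶜ).Nonempty →
        ∃ g : X α → Y, Continuous g ∧ ∀ x : ↥((of (X := X) α ⁻¹' C)ᶜ), g x = f x) := by
    intro α
    rcases ((of (X := X) α ⁻¹' C)ᶜ).eq_empty_or_nonempty with hα | hα
    · have : IsEmpty ↥((of (X := X) α ⁻¹' C)ᶜ) := isEmpty_coe_sort.2 hα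
      obtain ⟨Y, tY, f, h1, h2, hf⟩ :=
        exists_condensation_of_isEmpty ↥((of (X := X) α ⁻¹' C)ᶜ)
      exact ⟨Y, tY, f, h1, h2, hf, fun hne => absurd hα hne.ne_empty⟩
    · obtain ⟨Y, tY, f, g, h1, h2, hf, hg⟩ := (h α).2.2 _ (lift_mk_preimage_of_le hC α) hα
      exact ⟨Y, tY, f, h1, h2, hf, fun _ => ⟨g, hg⟩⟩
  choose Y tY f hY1 hY2 hf hfg using hdata
  choose g hgc hgf using hfg
  obtain ⟨Z, _, e, r, h1, h2, he, hr, hrxi, hrf⟩ := exists_compact_t2_quotient (S := Cᶜ) (f := f)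
    (fun α => (hf α).2) h0
  classical
  let G : SumWithPoint X → SumWithPoint Y := fun z => match z with
    | xi => xi
    | of α x => if hα : ((of (X := X) α ⁻¹' C)ᶜ).Nonempty then of α (g α hα x) else xi
  have hG : Continuous G := by
    refine continuous_of_summands rfl fun α => ?_
    by_cases hα : ((of (X := X) α ⁻¹' C)ᶜ).Nonempty
    · exact Or.inr ⟨g α hα, hgc α hα, fun x => dif_pos hα⟩
    · exact Or.inl fun x => dif_neg hα
  have hrG : ∀ z : ↥(Cᶜ), r (G z) = e z := by
    rintro ⟨_ | ⟨α, x⟩, hz⟩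
    · exact hrxi hz
    · have hα : ((of (X := X) α ⁻¹' C)ᶜ).Nonempty := ⟨x, hz⟩
      have : G (of α x) = of α (f α ⟨x, hz⟩) :=
        (dif_pos hα).trans (congrArg (of α) (hgf α hα ⟨x, hz⟩))
      exact (congrArg r this).trans (hrf α x hz)
  have heq : (fun z : ↥(Cᶜ) => r (G z)) = e := funext hrG
  refine ⟨Z, _, e, r ∘ G, h1, h2, ⟨?_, he⟩, hr.comp hG, hrG⟩
  rw [← heq]
  exact (hr.comp hG).comp continuous_subtype_val

end SumWithPoint

theorem theorem2p15 {Λ : Type v} (X : Λ → Type u) [∀ α, TopologicalSpace (X α)]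
    [∀ α, CompactSpace (X α)] [∀ α, T2Space (X α)]
    (τ : Cardinal.{w}) (hτ : ℵ₀ ≤ τ) :
    (IsASpace τ (SumWithPoint X) ↔ ∀ α, IsASpace τ (X α)) ∧
    (IsStrictlyASpace τ (SumWithPoint X) ↔ ∀ α, IsStrictlyASpace τ (X α)) :=
  ⟨⟨SumWithPoint.isASpace_of_sumWithPoint, SumWithPoint.isASpace_sumWithPoint⟩,
    ⟨SumWithPoint.isStrictlyASpace_of_sumWithPoint, SumWithPoint.isStrictlyASpace_sumWithPoint⟩⟩
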